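/- **Setting.** Let $\mathcal H$ be a separable complex Hilbert space, $L(\mathcal H)$ its bounded operators, and $\mathcal T(\mathcal H)$ its trace class operators, so that $\mathcal T(\mathcal H)^*=L(\mathcal H)$ under $(S,A)\mapsto \mathrm{Tr}[SA]$. Let $\mathrm{Aut}(\mathcal T(\mathcal H))$ be the group of positive, trace norm preserving linear bijections of $\mathcal T(\mathcal H)$, with the weak topology given by the functionals $u\mapsto \mathrm{Tr}[A\,u(S)]$, $A\in L(\mathcal H)$, $S\in\mathcal T(\mathcal H)$. Let $G$ be a locally compact, second countable, Hausdorff, unimodular group with Haar measure $\lambda$, let $\beta:G\to\mathrm{Aut}(\mathcal T(\mathcal H))$ be a continuous homomorphism, and let $d>0$ be such that $$\int_G \mathrm{Tr}[P_1\,\beta(g)(P_2)]\,d\lambda(g)=d$$ for all one-dimensional projections $P_1,P_2$ on $\mathcal H$. Write $\beta(g)^*:L(\mathcal H)\to L(\mathcal H)$ for the adjoint of $\beta(g)$. Let $E:\mathcal B(G)\to L(\mathcal H)$ be an observable, i.e. a positive operator measure (weakly $\sigma$-additive) with $E(G)=I$. It is called $\beta$-covariant if $\beta(g)^*(E(B))=E(g^{-1}B)$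 for all $g\in G$ and $B\in\mathcal B(G)$. A linear map $\Gamma:L^\infty(G,\lambda)\to L(\mathcal H)$ is called $\beta$-covariant if $\beta(g)^*(\Gamma(f))=\Gamma(f(g\,\cdot))$ for all $g\in G$ and $f\in L^\infty(G,\lambda)$; it is called normal if it is continuous for the weak-* topologies of $L^\infty(G,\lambda)=L^1(G,\lambda)^*$ and $L(\mathcal H)=\mathcal T(\mathcal H)^*$. **Lemma.** (a) Assume that for each $S\in\mathcal T(\mathcal H)$ the complex measure $B\mapsto \mathrm{Tr}[S E(B)]$ is absolutely continuous with respect to $\lambda$. Then for each $f\in L^\infty(G,\lambda)$ the integral $\int f\,dE$ exists in the ultraweak sense: there is a unique operator $\int f\,dE\in L(\mathcal H)$ such that, for each $S\in\mathcal T(\mathcal H)$, $f$ is integrable with respect to $\mathrm{Tr}[SE(\cdot)]$ and $\mathrm{Tr}\big[S\int f\,dE\big]=\int f\,d(\mathrm{Tr}[SE(\cdot)])$; it does not depend on the representative of $f$. The map $f\mapsto\int f\,dE$ is linear, normal and positive, and $\int 1\,dE=I$. If $E$ is $\beta$-covariant, then so is the map $f\mapsto\int f\,dE$. (b) Assume that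 $E$ is $\beta$-covariant. Then for each $S\in\mathcal T(\mathcal H)$ the measure $B\mapsto\mathrm{Tr}[SE(B)]$ is absolutely continuous with respect to $\lambda$. Moreover, if $\mathcal H\neq\{0\}$, then $\mathrm{Tr}[E(B)]=d^{-1}\lambda(B)$, as an equality in $[0,\infty]$, for every $B\in\mathcal B(G)$. -/

import Mathlib

open MeasureTheory Set
open scoped ENNReal InnerProductSpace ComplexOrder Pointwise Topology

noncomputable section

namespace CovObs

/-! ### Trace class operators -/

section TraceClass

variable {H : Type*} [NormedAddCommGroup H] [InnerProductSpace ℂ H] [CompleteSpace H]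

variable (H) in
/-- The index set of a fixed orthonormal basis of `H`. -/
def basisIndex : Set H := Classical.choose (exists_hilbertBasis ℂ H)

variable (H) in
/-- A fixed orthonormal basis of the Hilbert space `H`, used to compute traces. -/
def onb : HilbertBasis (basisIndex H) ℂ H :=
  Classical.choose (Classical.choose_spec (exists_hilbertBasis ℂ H))

/-- The trace in `[0, ∞]` of a positive bounded operator. It does not depend on the basis
(`posTrace_eq`). -/
def posTrace (A : H →L[ℂ] H) : ℝ≥0∞ :=
  ∑' i, ENNReal.ofReal (⟪onb H i, A (onb H i)⟫_ℂ).re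

/-- The trace norm `‖T‖_tr = Tr |T|`, where `|T| = (T* T)^{1/2}`. -/
def traceNorm (T : H →L[ℂ] H) : ℝ≥0∞ := posTrace (CFC.abs T)

lemma parseval {ι : Type*} (b : HilbertBasis ι ℂ H) (x : H) :
    ∑' i, ‖⟪b i, x⟫_ℂ‖ₑ ^ 2 = ‖x‖ₑ ^ 2 := by
  have h := b.hasSum_inner_mul_inner x x
  have h2 : HasSum (fun i => ‖⟪b i, x⟫_ℂ‖ ^ 2) (‖x‖ ^ 2) := by
    have h3 := Complex.hasSum_re h
    have e1 : (⟪x, x⟫_ℂ).re = ‖x‖ ^ 2 := by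
      have := inner_self_eq_norm_sq (𝕜 := ℂ) x
      simpa using this
    rw [e1] at h3
    convert h3 using 2 with i
    rw [← inner_conj_symm x (b i), Complex.conj_mul']
    norm_cast
  have h4 : ∑' i, ENNReal.ofReal (‖⟪b i, x⟫_ℂ‖ ^ 2) = ENNReal.ofReal (‖x‖ ^ 2) := by
    rw [← h2.tsum_eq, ENNReal.ofReal_tsum_of_nonneg (fun i => by positivity) h2.summable]
  simpa [ENNReal.ofReal_pow, ofReal_norm] using h4

/-- The Hilbert–Schmidt sums of an operator and of its adjoint agree, in any two bases. -/
lemma tsum_enorm_sq_adjoint {ι κ : Type*} (b : HilbertBasis ι ℂ H) (c : HilbertBasis κ ℂ H)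
    (T : H →L[ℂ] H) :
    ∑' i, ‖T (b i)‖ₑ ^ 2 = ∑' j, ‖(ContinuousLinearMap.adjoint T) (c j)‖ₑ ^ 2 := by
  calc ∑' i, ‖T (b i)‖ₑ ^ 2 = ∑' i, ∑' j, ‖⟪c j, T (b i)⟫_ℂ‖ₑ ^ 2 := by
        simp_rw [parseval c]
    _ = ∑' j, ∑' i, ‖⟪c j, T (b i)⟫_ℂ‖ₑ ^ 2 := ENNReal.tsum_comm
    _ = ∑' j, ∑' i, ‖⟪b i, (ContinuousLinearMap.adjoint T) (c j)⟫_ℂ‖ₑ ^ 2 := by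
        congr! 5 with j i
        rw [ContinuousLinearMap.adjoint_inner_right, ← inner_conj_symm, enorm_eq_iff_norm_eq]
        exact RCLike.norm_conj _
    _ = _ := by simp_rw [parseval b]

/-- A positive operator is a square `R ^ 2` with `R` self-adjoint. -/
lemma exists_sqrt {A : H →L[ℂ] H} (hA : 0 ≤ A) :
    ∃ R : H →L[ℂ] H, ContinuousLinearMap.adjoint R = R ∧ A = R ∘L R := by
  refine ⟨CFC.sqrt A, ?_, (CFC.sqrt_mul_sqrt_self A hA).symm⟩
  exact (CFC.sqrt_nonneg A).isSelfAdjoint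

lemma ofReal_re_inner_sq {R : H →L[ℂ] H} (hR : ContinuousLinearMap.adjoint R = R) (x : H) :
    ENNReal.ofReal (⟪x, (R ∘L R) x⟫_ℂ).re = ‖R x‖ₑ ^ 2 := by
  have : ⟪x, (R ∘L R) x⟫_ℂ = ⟪R x, R x⟫_ℂ := by
    conv_rhs => rw [← ContinuousLinearMap.adjoint_inner_right, hR]
    rfl
  rw [this]
  have h := inner_self_eq_norm_sq (𝕜 := ℂ) (R x)
  simp only [RCLike.re_to_complex] at h
  rw [h, ENNReal.ofReal_pow (norm_nonneg _), ofReal_norm]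

/-- The trace of a positive operator can be computed in any orthonormal basis. -/
lemma posTrace_eq {ι : Type*} (b : HilbertBasis ι ℂ H) {A : H →L[ℂ] H} (hA : 0 ≤ A) :
    posTrace A = ∑' i, ENNReal.ofReal (⟪b i, A (b i)⟫_ℂ).re := by
  obtain ⟨R, hR, rfl⟩ := exists_sqrt hA
  unfold posTrace
  simp_rw [ofReal_re_inner_sq hR]
  rw [tsum_enorm_sq_adjoint (onb H) b R, hR]

lemma inner_abs_apply (T : H →L[ℂ] H) (x y : H) :
    ⟪CFC.abs T x, CFC.abs T y⟫_ℂ = ⟪T x, T y⟫_ℂ := by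
  have hsa : ContinuousLinearMap.adjoint (CFC.abs T) = CFC.abs T :=
    (CFC.abs_nonneg T).isSelfAdjoint
  have h : CFC.abs T (CFC.abs T y) = (ContinuousLinearMap.adjoint T) (T y) :=
    congrArg (fun S : H →L[ℂ] H => S y) (CFC.abs_mul_abs T)
  rw [← ContinuousLinearMap.adjoint_inner_right, hsa, h, ContinuousLinearMap.adjoint_inner_right]

/-- Polar decomposition: `T = W |T|` and `|T| = W* T` for some bounded operator `W`. -/
lemma exists_polar (T : H →L[ℂ] H) : ∃ W : H →L[ℂ] H,
    T = W ∘L CFC.abs T ∧ CFC.abs T = ContinuousLinearMap.adjoint W ∘L T := by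
  set A := CFC.abs T with hA
  have hnorm : ∀ x, ‖T x‖ = ‖A x‖ := by
    intro x
    have h := inner_abs_apply T x x
    rw [inner_self_eq_norm_sq_to_K, inner_self_eq_norm_sq_to_K] at h
    have h' : ‖A x‖ ^ 2 = ‖T x‖ ^ 2 := by exact_mod_cast h
    exact ((sq_eq_sq₀ (norm_nonneg _) (norm_nonneg _)).1 h').symm
  let K : Submodule ℂ H := A.range.topologicalClosure
  have hmem : ∀ x, A x ∈ K := fun x => A.range.le_topologicalClosure ⟨x, rfl⟩
  let e : H →ₗ[ℂ] K := A.toLinearMap.codRestrict K hmem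
  have hdense : DenseRange e := by
    rw [Metric.denseRange_iff]
    rintro ⟨y, hy⟩ r hr
    obtain ⟨z, ⟨x, rfl⟩, hz⟩ := Metric.mem_closure_iff.1 hy r hr
    exact ⟨x, hz⟩
  have hbound : ∃ C : ℝ, ∀ x, ‖T.toLinearMap x‖ ≤ C * ‖e x‖ :=
    ⟨1, fun x => by rw [one_mul]; exact (hnorm x).le⟩
  let U : K →L[ℂ] H := T.toLinearMap.extendOfNorm e
  have hU : ∀ x, U (e x) = T x := LinearMap.extendOfNorm_eq hdense hbound
  have : CompleteSpace K := A.range.isClosed_topologicalClosure.completeSpace_coe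
  let W : H →L[ℂ] H := U ∘L K.orthogonalProjectionOnto
  have hWA : ∀ x, W (A x) = T x := by
    intro x
    have h1 : K.orthogonalProjectionOnto (A x) = e x := by
      apply Subtype.ext
      exact Submodule.starProjection_eq_self_iff.2 (hmem x)
    change U (K.orthogonalProjectionOnto (A x)) = T x
    rw [h1, hU]
  refine ⟨W, ?_, ?_⟩
  · ext x; exact (hWA x).symm
  · ext x
    refine ext_inner_left ℂ fun y => ?_
    rw [ContinuousLinearMap.comp_apply, ContinuousLinearMap.adjoint_inner_right]
    have key : ∀ k : K, ⟪(k : H), A x⟫_ℂ = ⟪U k, T x⟫_ℂ := by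
      intro k
      have hf : Continuous fun k : K => ⟪(k : H), A x⟫_ℂ := by fun_prop
      have hg : Continuous fun k : K => ⟪U k, T x⟫_ℂ := by fun_prop
      refine congrFun (DenseRange.equalizer hdense hf hg ?_) k
      funext z
      change ⟪A z, A x⟫_ℂ = ⟪U (e z), T x⟫_ℂ
      rw [hU]; exact inner_abs_apply T z x
    have hy : ⟪y, A x⟫_ℂ = ⟪(K.orthogonalProjectionOnto y : H), A x⟫_ℂ := by
      have := K.starProjection_inner_eq_zero y (A x) (hmem x)
      rw [inner_sub_left, sub_eq_zero] at this
      exact this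
    rw [hy, key]; rfl

lemma tsum_comp_ne_top {R X : H →L[ℂ] H} (hR : ContinuousLinearMap.adjoint R = R)
    (h : ∑' i, ‖R (onb H i)‖ₑ ^ 2 ≠ ∞) : ∑' i, ‖R (X (onb H i))‖ₑ ^ 2 ≠ ∞ := by
  have e := tsum_enorm_sq_adjoint (onb H) (onb H) (R ∘L X)
  rw [ContinuousLinearMap.adjoint_comp, hR] at e
  change ∑' i, ‖(R ∘L X) (onb H i)‖ₑ ^ 2 ≠ ∞
  rw [e]
  refine ne_top_of_le_ne_top (ENNReal.mul_ne_top (a := ‖ContinuousLinearMap.adjoint X‖ₑ ^ 2)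
    (by finiteness) h) ?_
  rw [← ENNReal.tsum_mul_left]
  refine ENNReal.tsum_le_tsum fun i => ?_
  rw [← mul_pow]
  gcongr
  exact ContinuousLinearMap.le_opENorm _ _

/-- Absolute convergence of the trace series of `Y S` for `Tr |S| < ∞`. -/
lemma tsum_enorm_inner_ne_top {S : H →L[ℂ] H} (hS : traceNorm S ≠ ∞) (Y : H →L[ℂ] H) :
    ∑' i, ‖⟪onb H i, Y (S (onb H i))⟫_ℂ‖ₑ ≠ ∞ := by
  obtain ⟨W, hW, -⟩ := exists_polar S
  obtain ⟨R, hR, hA⟩ := exists_sqrt (CFC.abs_nonneg S)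
  have h1 : ∑' i, ‖R (onb H i)‖ₑ ^ 2 ≠ ∞ := by
    have : traceNorm S = ∑' i, ‖R (onb H i)‖ₑ ^ 2 := by
      unfold traceNorm posTrace
      rw [hA]
      simp_rw [ofReal_re_inner_sq hR]
    rwa [this] at hS
  set X := ContinuousLinearMap.adjoint (Y ∘L W)
  have h2 := tsum_comp_ne_top (X := X) hR h1
  refine ne_top_of_le_ne_top (ENNReal.add_ne_top.2 ⟨h2, h1⟩) ?_
  rw [← ENNReal.tsum_add]
  refine ENNReal.tsum_le_tsum fun i => ?_
  have e : ⟪onb H i, Y (S (onb H i))⟫_ℂ = ⟪R (X (onb H i)), R (onb H i)⟫_ℂ := by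
    have e1 : Y (S (onb H i)) = (Y ∘L W) (R (R (onb H i))) := by
      conv_lhs => rw [hW, hA]
      rfl
    rw [e1, ← ContinuousLinearMap.adjoint_inner_left]
    conv_rhs => rw [← hR, ContinuousLinearMap.adjoint_inner_left, hR]
  rw [e]
  set u := R (X (onb H i))
  set v := R (onb H i)
  have h3 : ‖⟪u, v⟫_ℂ‖ ≤ ‖u‖ ^ 2 + ‖v‖ ^ 2 := by
    have := norm_inner_le_norm (𝕜 := ℂ) u v
    nlinarith [sq_nonneg (‖u‖ - ‖v‖), sq_nonneg ‖u‖, sq_nonneg ‖v‖]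
  have h4 := ENNReal.ofReal_le_ofReal h3
  rwa [ENNReal.ofReal_add (by positivity) (by positivity), ENNReal.ofReal_pow (norm_nonneg _),
    ENNReal.ofReal_pow (norm_nonneg _), ofReal_norm, ofReal_norm,
    ofReal_norm] at h4

lemma ofReal_re_le_enorm (z : ℂ) : ENNReal.ofReal z.re ≤ ‖z‖ₑ := by
  rw [← ofReal_norm]
  exact ENNReal.ofReal_le_ofReal (Complex.re_le_norm z)

lemma traceNorm_add_ne_top {S T : H →L[ℂ] H} (hS : traceNorm S ≠ ∞) (hT : traceNorm T ≠ ∞) :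
    traceNorm (S + T) ≠ ∞ := by
  obtain ⟨W, -, hW⟩ := exists_polar (S + T)
  refine ne_top_of_le_ne_top (ENNReal.add_ne_top.2
    ⟨tsum_enorm_inner_ne_top hS (ContinuousLinearMap.adjoint W),
      tsum_enorm_inner_ne_top hT (ContinuousLinearMap.adjoint W)⟩) ?_
  rw [← ENNReal.tsum_add]
  refine ENNReal.tsum_le_tsum fun i => ?_
  rw [hW]
  refine (ofReal_re_le_enorm _).trans ?_
  simp only [ContinuousLinearMap.comp_apply, _root_.add_apply, map_add, inner_add_right]
  exact enorm_add_le _ _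

lemma traceNorm_smul_ne_top {S : H →L[ℂ] H} (c : ℂ) (hS : traceNorm S ≠ ∞) :
    traceNorm (c • S) ≠ ∞ := by
  obtain ⟨W, -, hW⟩ := exists_polar (c • S)
  refine ne_top_of_le_ne_top (tsum_enorm_inner_ne_top hS (c • ContinuousLinearMap.adjoint W)) ?_
  refine ENNReal.tsum_le_tsum fun i => ?_
  rw [hW]
  refine (ofReal_re_le_enorm _).trans (le_of_eq ?_)
  simp

variable (H) in
/-- The space `𝒯(H)` of trace class operators: the bounded operators `T` with `Tr |T| < ∞`. -/
def TraceClass : Submodule ℂ (H →L[ℂ] H) where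
  carrier := {T | traceNorm T ≠ ∞}
  zero_mem' := by simp [traceNorm, posTrace]
  add_mem' := traceNorm_add_ne_top
  smul_mem' c _ := traceNorm_smul_ne_top c

/-- The trace `Tr T` (an absolutely convergent series when `T` is trace class). -/
def tr (T : H →L[ℂ] H) : ℂ := ∑' i, ⟪onb H i, T (onb H i)⟫_ℂ

/-- `P` is a one-dimensional orthogonal projection. -/
def IsOneDimProjection (P : H →L[ℂ] H) : Prop :=
  IsStarProjection P ∧ Module.finrank ℂ P.range = 1

/-- `u` is an element of `Aut(𝒯(H))`: a linear bijection of `𝒯(H)` which is positive and preserves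
the trace norm (so that it is a homeomorphism for the trace norm). -/
structure IsTraceAut (u : TraceClass H ≃ₗ[ℂ] TraceClass H) : Prop where
  positive : ∀ S : TraceClass H, (S : H →L[ℂ] H).IsPositive → (u S : H →L[ℂ] H).IsPositive
  traceNorm_eq : ∀ S : TraceClass H, traceNorm (u S : H →L[ℂ] H) = traceNorm (S : H →L[ℂ] H)

/-- `A' = u^*(A)`, where `u^* : L(H) → L(H)` is the adjoint of `u : 𝒯(H) → 𝒯(H)` under the duality
`𝒯(H)^* = L(H)`, `⟨S, A⟩ = Tr[S A]`. As the pairing is nondegenerate, `A'` is determined by `u`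
and `A`. -/
def IsDualImage (u : TraceClass H ≃ₗ[ℂ] TraceClass H) (A A' : H →L[ℂ] H) : Prop :=
  ∀ S : TraceClass H, tr ((S : H →L[ℂ] H) ∘L A') = tr ((u S : H →L[ℂ] H) ∘L A)

variable (H) in
/-- The ultraweak (weak-*) topology of `L(H) = 𝒯(H)^*`. -/
@[reducible] def ultraweakTopology : TopologicalSpace (H →L[ℂ] H) :=
  TopologicalSpace.induced (fun A (S : TraceClass H) => tr ((S : H →L[ℂ] H) ∘L A))
    Pi.topologicalSpace

end TraceClass

/-- The weak-* topology of `L^∞(G, lam) = L^1(G, lam)^*`. -/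
@[reducible] def weakStarTopology {G : Type*} [MeasurableSpace G] (lam : Measure G) :
    TopologicalSpace (Lp ℂ ∞ lam) :=
  TopologicalSpace.induced (fun f (h : Lp ℂ 1 lam) => ∫ x, h x * f x ∂lam) Pi.topologicalSpace

/-! ### Phase space systems, observables, operator integrals -/

section Observables

variable {G : Type*} [Group G] [TopologicalSpace G] [MeasurableSpace G]
variable {H : Type*} [NormedAddCommGroup H] [InnerProductSpace ℂ H] [CompleteSpace H]

/-- `(G, β, d)` is a phase space system for the Haar measure `lam`: `β : G → Aut(𝒯(H))` is a
homomorphism, continuous for the weak topology of the functionals `u ↦ Tr[A u(S)]`, and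
`∫ Tr[P₁ β(g)(P₂)] d lam(g) = d > 0` for all one-dimensional projections `P₁`, `P₂`.
(Since `d > 0`, the integrand is integrable.) -/
structure IsPhaseSpaceSystem (lam : Measure G)
    (β : G →* (TraceClass H ≃ₗ[ℂ] TraceClass H)) (d : ℝ) : Prop where
  aut : ∀ g, IsTraceAut (β g)
  continuous : ∀ (A : H →L[ℂ] H) (S : TraceClass H),
    Continuous fun g => tr (A ∘L (β g S : H →L[ℂ] H))
  d_pos : 0 < d
  integral_eq : ∀ P₁ P₂ : TraceClass H, IsOneDimProjection (P₁ : H →L[ℂ] H) →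
    IsOneDimProjection (P₂ : H →L[ℂ] H) →
    ∫ g, tr ((P₁ : H →L[ℂ] H) ∘L (β g P₂ : H →L[ℂ] H)) ∂lam = (d : ℂ)

variable (G H) in
/-- An observable on `G`: a positive operator measure, weakly countably additive and normalized.
Only the values on measurable sets matter. -/
structure Observable where
  /-- The effect of a measurable set. -/
  toFun : Set G → (H →L[ℂ] H)
  positive : ∀ B, MeasurableSet B → (toFun B).IsPositive
  normalized : toFun univ = 1
  countably_additive : ∀ B : ℕ → Set G, (∀ n, MeasurableSet (B n)) →
    Pairwise (Function.onFun Disjoint B) → ∀ φ ψ : H,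
      HasSum (fun n => ⟪φ, toFun (B n) ψ⟫_ℂ) ⟪φ, toFun (⋃ n, B n) ψ⟫_ℂ

instance : CoeFun (Observable G H) fun _ => Set G → (H →L[ℂ] H) := ⟨Observable.toFun⟩

/-- For each trace class operator `S`, the measure `B ↦ Tr[S E(B)]` is absolutely continuous with
respect to `lam`. -/
def Observable.IsAbsCont (E : Observable G H) (lam : Measure G) : Prop :=
  ∀ (S : TraceClass H) (B : Set G), MeasurableSet B → lam B = 0 →
    tr ((S : H →L[ℂ] H) ∘L E B) = 0

/-- `E` is `β`-covariant: `β(g)^*(E(B)) = E(g⁻¹ B)`. -/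
def Observable.IsCovariant (E : Observable G H)
    (β : G →* (TraceClass H ≃ₗ[ℂ] TraceClass H)) : Prop :=
  ∀ (g : G) (B : Set G), MeasurableSet B → IsDualImage (β g) (E B) (E (g⁻¹ • B))

/-- The operator integral `∫ f dE` exists in the ultraweak sense and equals `A ∈ L(H)`: for each
trace class operator `S`, the set function `B ↦ Tr[S E(B)]` is a complex measure `μ`, the function
`f` is integrable with respect to (the total variation of) `μ`, and `Tr[S A] = ∫ f dμ`. -/
def Observable.HasIntegral (E : Observable G H) (f : G → ℂ) (A : H →L[ℂ] H) : Prop :=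
  ∀ S : TraceClass H, ∃ μ : ComplexMeasure G,
    (∀ B, MeasurableSet B → μ B = tr ((S : H →L[ℂ] H) ∘L E B)) ∧
    Integrable f μ.variation ∧
    tr ((S : H →L[ℂ] H) ∘L A) = μ.integral f (ContinuousLinearMap.mul ℝ ℂ)

/-- `Γ` is normal: continuous for the weak-* topologies of `L^∞ = (L^1)^*` and
`L(H) = 𝒯(H)^*`. -/
def IsNormalMap (lam : Measure G) (Γ : Lp ℂ ∞ lam →ₗ[ℂ] (H →L[ℂ] H)) : Prop :=
  Continuous[weakStarTopology lam, ultraweakTopology H] Γ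

/-- `Γ` is positive: `f ≥ 0` implies `Γ(f) ≥ 0`. -/
def IsPositiveMap (lam : Measure G) (Γ : Lp ℂ ∞ lam →ₗ[ℂ] (H →L[ℂ] H)) : Prop :=
  ∀ f : Lp ℂ ∞ lam, (∀ᵐ x ∂lam, 0 ≤ f x) → (Γ f).IsPositive

/-- `Γ` is `β`-covariant: `β(g)^*(Γ(f)) = Γ(f(g ·))`. -/
def IsCovariantMap [IsTopologicalGroup G] [BorelSpace G] (lam : Measure G)
    [lam.IsMulLeftInvariant] (β : G →* (TraceClass H ≃ₗ[ℂ] TraceClass H))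
    (Γ : Lp ℂ ∞ lam →ₗ[ℂ] (H →L[ℂ] H)) : Prop :=
  ∀ (g : G) (f : Lp ℂ ∞ lam), IsDualImage (β g) (Γ f)
    (Γ (Lp.compMeasurePreserving (fun x => g * x) (measurePreserving_mul_left lam g) f))

end Observables

end CovObs

end

/-!
Everything rests on one description of the trace pairing. A trace class operator factors as
`S = W R²` with `R` self-adjoint and Hilbert–Schmidt, and cyclicity of the trace gives
`Tr[S A] = ∑ ⟪R eᵢ, A W R eᵢ⟫`; polarization turns this into four series of expectation values
`⟪z, A z⟫` with square summable vectors `z` (`exists_hasSum_quadratic`).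

For the operator integral, `B ↦ ⟪z, E(B) z⟫` is a finite positive measure, so `Tr[S E(·)]` is a
combination of four finite measures, and it has a density in `L¹(lam)` when `E` is absolutely
continuous (`IsAbsCont.exists_density`). The density is unique, hence linear in `S`; applied to the
operators `v ↦ ⟪x, v⟫ y` it gives, for a bounded `f`, a bounded sesquilinear form and thus an
operator `Γ f` with `Tr[S (Γ f)] = ∫ f D(S) d lam`, where `D(S)` is the density
(`IsAbsCont.exists_operator`). This formula makes `Γ` visibly normal, and covariant because the
density of `β(g) S` is the left translate of `D(S)`. It is also the integral of `f` against the
complex measure `Tr[S E(·)]`, since integrating against a complex measure with a density is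
integrating the product (`integral_withDensityᵥ`).

For the trace formula, let `P` be the projection onto a unit vector `φ`. The integral
`∫ Tr[β(g)(P) E(B)] d lam(g)` is computed in two ways. Writing `E(B) = R²` and expanding the trace
of `R β(g)(P) R` in a basis, the orthogonality relation gives `d Tr[E(B)]`
(`IsPhaseSpaceSystem.lintegral_tr_comp`). By covariance the integrand is `⟪φ, E(g⁻¹ B) φ⟫`, and
Fubini with right invariance gives `lam B` (`lintegral_measure_inv_smul`). In particular a null set
has an effect of trace zero, that is the zero operator, so `E` is absolutely continuous.
-/

/-! ### The trace pairing -/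

namespace CovObs

section Trace

variable {H : Type*} [NormedAddCommGroup H] [InnerProductSpace ℂ H] [CompleteSpace H]

open ContinuousLinearMap InnerProductSpace

lemma summable_of_tsum_enorm_ne_top {ι : Type*} {f : ι → ℂ} (h : ∑' i, ‖f i‖ₑ ≠ ∞) :
    Summable f := by
  refine Summable.of_norm ?_
  have := ENNReal.summable_toReal h
  simpa using this

lemma enorm_mul_le_sq_add_sq (a b : ℝ≥0∞) : a * b ≤ a ^ 2 + b ^ 2 := by
  rcases le_total a b with h | h
  · exact (mul_le_mul_left h b).trans (by rw [← pow_two]; exact le_add_self)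
  · exact (mul_le_mul_right h a).trans (by rw [← pow_two]; exact le_self_add)

/-- The double series `∑ ⟪eᵢ, X eⱼ⟫ ⟪eⱼ, Y eᵢ⟫` of two Hilbert–Schmidt operators converges
absolutely. -/
lemma summable_inner_mul_inner_of_hilbertSchmidt {X Y : H →L[ℂ] H}
    (hX : ∑' i, ‖X (onb H i)‖ₑ ^ 2 ≠ ∞) (hY : ∑' i, ‖Y (onb H i)‖ₑ ^ 2 ≠ ∞) :
    Summable fun p : basisIndex H × basisIndex H =>
      ⟪onb H p.1, X (onb H p.2)⟫_ℂ * ⟪onb H p.2, Y (onb H p.1)⟫_ℂ := by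
  refine summable_of_tsum_enorm_ne_top (ne_top_of_le_ne_top (ENNReal.add_ne_top.2 ⟨hX, hY⟩) ?_)
  calc _ ≤ ∑' p : basisIndex H × basisIndex H, (‖⟪onb H p.1, X (onb H p.2)⟫_ℂ‖ₑ ^ 2 +
        ‖⟪onb H p.2, Y (onb H p.1)⟫_ℂ‖ₑ ^ 2) := ENNReal.tsum_le_tsum fun p => by
          rw [enorm_mul]; exact enorm_mul_le_sq_add_sq _ _
    _ = _ := by
      rw [ENNReal.tsum_add, ENNReal.tsum_prod', ENNReal.tsum_prod', ENNReal.tsum_comm]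
      simp_rw [parseval]

lemma hasSum_tr_comp {X Y : H →L[ℂ] H}
    (hX : ∑' i, ‖X (onb H i)‖ₑ ^ 2 ≠ ∞) (hY : ∑' i, ‖Y (onb H i)‖ₑ ^ 2 ≠ ∞) :
    HasSum (fun i => ⟪onb H i, X (Y (onb H i))⟫_ℂ) (tr (X ∘L Y)) := by
  have h := (summable_inner_mul_inner_of_hilbertSchmidt hX hY).hasSum.prod_fiberwise
    (g := fun i => ⟪onb H i, X (Y (onb H i))⟫_ℂ) fun i => by
      have := (onb H).hasSum_inner_mul_inner (adjoint X (onb H i)) (Y (onb H i))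
      simpa only [adjoint_inner_left] using this
  exact h.summable.hasSum

/-- Cyclicity of the trace for products of two Hilbert–Schmidt operators. -/
lemma tr_comp_comm {X Y : H →L[ℂ] H}
    (hX : ∑' i, ‖X (onb H i)‖ₑ ^ 2 ≠ ∞) (hY : ∑' i, ‖Y (onb H i)‖ₑ ^ 2 ≠ ∞) :
    tr (X ∘L Y) = tr (Y ∘L X) := by
  have key : ∀ {X Y : H →L[ℂ] H}, tr (X ∘L Y) =
      ∑' i, ∑' j, ⟪onb H i, X (onb H j)⟫_ℂ * ⟪onb H j, Y (onb H i)⟫_ℂ := by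
    intro X Y
    refine tsum_congr fun i => ?_
    have := (onb H).hasSum_inner_mul_inner (adjoint X (onb H i)) (Y (onb H i))
    simp only [adjoint_inner_left] at this
    exact this.tsum_eq.symm
  rw [key, key, ← Summable.tsum_comm
    (f := fun i j => ⟪onb H i, X (onb H j)⟫_ℂ * ⟪onb H j, Y (onb H i)⟫_ℂ)
    (summable_inner_mul_inner_of_hilbertSchmidt hX hY)]
  exact tsum_congr fun i => tsum_congr fun j => mul_comm _ _

lemma tsum_comp_left_ne_top {X : H →L[ℂ] H} (A : H →L[ℂ] H)
    (hX : ∑' i, ‖X (onb H i)‖ₑ ^ 2 ≠ ∞) : ∑' i, ‖(A ∘L X) (onb H i)‖ₑ ^ 2 ≠ ∞ := by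
  refine ne_top_of_le_ne_top (ENNReal.mul_ne_top (a := ‖A‖ₑ ^ 2) (by finiteness) hX) ?_
  rw [← ENNReal.tsum_mul_left]
  refine ENNReal.tsum_le_tsum fun i => ?_
  rw [← mul_pow]
  gcongr
  exact le_opENorm _ _

/-- A factorization `S = W R²` of a trace class operator, with `R = |S|^{1/2}` self-adjoint and
Hilbert–Schmidt and `W` the phase of the polar decomposition, which is `1` for positive `S`. -/
lemma exists_factorization (S : TraceClass H) : ∃ W R : H →L[ℂ] H, adjoint R = R ∧
    ∑' i, ‖R (onb H i)‖ₑ ^ 2 ≠ ∞ ∧ (S : H →L[ℂ] H) = W ∘L R ∘L R ∧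
      ((S : H →L[ℂ] H).IsPositive → W = 1) := by
  have main : ∀ R : H →L[ℂ] H, adjoint R = R → CFC.abs (S : H →L[ℂ] H) = R ∘L R →
      ∑' i, ‖R (onb H i)‖ₑ ^ 2 ≠ ∞ := by
    intro R hR hA
    have h1 : traceNorm (S : H →L[ℂ] H) ≠ ∞ := S.2
    unfold traceNorm posTrace at h1
    rw [hA] at h1
    simpa only [ofReal_re_inner_sq hR] using h1
  obtain ⟨W, hW, -⟩ := exists_polar (S : H →L[ℂ] H)
  obtain ⟨R, hR, hA⟩ := exists_sqrt (CFC.abs_nonneg (S : H →L[ℂ] H))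
  by_cases hS : (S : H →L[ℂ] H).IsPositive
  · refine ⟨1, R, hR, main R hR hA, ?_, fun _ => rfl⟩
    rw [← hA, CFC.abs_of_nonneg _ ((ContinuousLinearMap.nonneg_iff_isPositive _).2 hS)]
    rfl
  · exact ⟨W, R, hR, main R hR hA, by rw [← hA]; exact hW, fun h => absurd h hS⟩

/-- For `S = W R²`, cyclicity moves `A` between the two factors `R`: the trace `Tr[S A]` is the
series of matrix elements of `A` between two square summable families. -/
lemma hasSum_tr_factorization_comp {W R : H →L[ℂ] H} (hR : adjoint R = R)
    (hR2 : ∑' i, ‖R (onb H i)‖ₑ ^ 2 ≠ ∞) (A : H →L[ℂ] H) :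
    HasSum (fun i => ⟪R (onb H i), A (W (R (onb H i)))⟫_ℂ) (tr ((W ∘L R ∘L R) ∘L A)) := by
  have h1 := tsum_comp_left_ne_top W hR2
  have h2 : ∑' i, ‖(R ∘L A) (onb H i)‖ₑ ^ 2 ≠ ∞ := tsum_comp_ne_top (X := A) hR hR2
  have h := hasSum_tr_comp h2 h1
  rw [← tr_comp_comm h1 h2] at h
  have e : ∀ i, ⟪R (onb H i), A (W (R (onb H i)))⟫_ℂ =
      ⟪onb H i, (R ∘L A) ((W ∘L R) (onb H i))⟫_ℂ := fun i => by
    conv_rhs => rw [comp_apply, ← hR, adjoint_inner_right, hR, comp_apply]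
  simp_rw [e]
  exact h

lemma summable_tr_comp (S : TraceClass H) (A : H →L[ℂ] H) :
    Summable fun i => ⟪onb H i, ((S : H →L[ℂ] H) ∘L A) (onb H i)⟫_ℂ := by
  obtain ⟨W, R, hR, hR2, hS, -⟩ := exists_factorization S
  have h1 := tsum_comp_left_ne_top W hR2
  have h2 : ∑' i, ‖(R ∘L A) (onb H i)‖ₑ ^ 2 ≠ ∞ := tsum_comp_ne_top (X := A) hR hR2
  rw [hS]
  exact (hasSum_tr_comp h1 h2).summable

lemma tr_add_comp (S T : TraceClass H) (A : H →L[ℂ] H) :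
    tr (((S + T : TraceClass H) : H →L[ℂ] H) ∘L A) =
      tr ((S : H →L[ℂ] H) ∘L A) + tr ((T : H →L[ℂ] H) ∘L A) := by
  unfold tr
  rw [← (summable_tr_comp S A).tsum_add (summable_tr_comp T A)]
  exact tsum_congr fun i => inner_add_right _ _ _

lemma tr_smul_comp (c : ℂ) (S : TraceClass H) (A : H →L[ℂ] H) :
    tr (((c • S : TraceClass H) : H →L[ℂ] H) ∘L A) = c * tr ((S : H →L[ℂ] H) ∘L A) := by
  unfold tr
  rw [← tsum_mul_left]
  exact tsum_congr fun i => inner_smul_right _ _ _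

lemma tr_comp_add (S : TraceClass H) (A B : H →L[ℂ] H) :
    tr ((S : H →L[ℂ] H) ∘L (A + B)) =
      tr ((S : H →L[ℂ] H) ∘L A) + tr ((S : H →L[ℂ] H) ∘L B) := by
  unfold tr
  rw [← (summable_tr_comp S A).tsum_add (summable_tr_comp S B)]
  exact tsum_congr fun i => by
    rw [ContinuousLinearMap.comp_add]
    exact inner_add_right _ _ _

lemma tr_comp_smul (c : ℂ) (S : TraceClass H) (A : H →L[ℂ] H) :
    tr ((S : H →L[ℂ] H) ∘L (c • A)) = c * tr ((S : H →L[ℂ] H) ∘L A) := by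
  unfold tr
  rw [← tsum_mul_left]
  exact tsum_congr fun i => by
    rw [ContinuousLinearMap.comp_smul]
    exact inner_smul_right _ _ _

lemma rankOne_mem_traceClass (x y : H) : rankOne ℂ y x ∈ TraceClass H := by
  change traceNorm _ ≠ ∞
  obtain ⟨W, -, hW⟩ := exists_polar (rankOne ℂ y x)
  unfold traceNorm posTrace
  rw [hW]
  have h1 : ∑' i, ‖⟪onb H i, x⟫_ℂ‖ₑ ^ 2 ≠ ∞ := by rw [parseval]; finiteness
  have h2 : ∑' i, ‖⟪onb H i, adjoint W y⟫_ℂ‖ₑ ^ 2 ≠ ∞ := by rw [parseval]; finiteness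
  refine ne_top_of_le_ne_top (ENNReal.add_ne_top.2 ⟨h1, h2⟩) ?_
  rw [← ENNReal.tsum_add]
  refine ENNReal.tsum_le_tsum fun i => (ofReal_re_le_enorm _).trans ?_
  refine le_trans (le_of_eq ?_) (enorm_mul_le_sq_add_sq _ _)
  rw [comp_apply, rankOne_apply, map_smul, inner_smul_right, enorm_mul, ← inner_conj_symm]
  congr 1
  rw [enorm_eq_iff_norm_eq]
  exact RCLike.norm_conj _

/-- The operator `v ↦ ⟪x, v⟫ y` as an element of the trace class. -/
noncomputable def rankOneTC (x y : H) : TraceClass H := ⟨rankOne ℂ y x, rankOne_mem_traceClass x y⟩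

lemma rankOneTC_add_left (x x' y : H) : rankOneTC (x + x') y = rankOneTC x y + rankOneTC x' y :=
  Subtype.ext (map_add (rankOne ℂ y) x x')

lemma rankOneTC_smul_left (c : ℂ) (x y : H) :
    rankOneTC (c • x) y = (starRingEnd ℂ) c • rankOneTC x y :=
  Subtype.ext (map_smulₛₗ (rankOne ℂ y) c x)

lemma rankOneTC_add_right (x y y' : H) : rankOneTC x (y + y') = rankOneTC x y + rankOneTC x y' :=
  Subtype.ext (by simp [rankOneTC])

lemma rankOneTC_smul_right (c : ℂ) (x y : H) : rankOneTC x (c • y) = c • rankOneTC x y :=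
  Subtype.ext (by simp [rankOneTC])

lemma tr_rankOneTC_comp (x y : H) (A : H →L[ℂ] H) :
    tr ((rankOneTC x y : H →L[ℂ] H) ∘L A) = ⟪x, A y⟫_ℂ := by
  have h := (onb H).hasSum_inner_mul_inner (adjoint A x) y
  rw [adjoint_inner_left] at h
  rw [← h.tsum_eq]
  refine tsum_congr fun i => ?_
  rw [comp_apply, adjoint_inner_left]
  change ⟪onb H i, rankOne ℂ y x _⟫_ℂ = _
  rw [rankOne_apply, inner_smul_right]

/-- The pairing `(S, A) ↦ Tr[S A]` separates bounded operators. -/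
lemma eq_of_forall_tr_comp_eq {A B : H →L[ℂ] H}
    (h : ∀ S : TraceClass H, tr ((S : H →L[ℂ] H) ∘L A) = tr ((S : H →L[ℂ] H) ∘L B)) : A = B := by
  ext y
  refine ext_inner_left ℂ fun x => ?_
  simpa only [tr_rankOneTC_comp] using h (rankOneTC x y)

lemma rankOneTC_isOneDimProjection {u : H} (hu : ‖u‖ = 1) :
    IsOneDimProjection (rankOneTC u u : H →L[ℂ] H) := by
  have hu0 : u ≠ 0 := by rintro rfl; simp at hu
  refine ⟨⟨isIdempotentElem_rankOne_self hu, ?_⟩, ?_⟩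
  · exact (isPositive_rankOne_self u).isSelfAdjoint
  · have : (rankOneTC u u : H →L[ℂ] H).range = Submodule.span ℂ {u} := by
      ext v
      simp only [LinearMap.mem_range, Submodule.mem_span_singleton]
      constructor
      · rintro ⟨w, rfl⟩
        exact ⟨⟪u, w⟫_ℂ, rfl⟩
      · rintro ⟨c, rfl⟩
        refine ⟨c • u, ?_⟩
        change rankOne ℂ u u _ = _
        rw [rankOne_apply, inner_smul_right, inner_self_eq_norm_sq_to_K, hu]
        simp
    rw [this]
    exact finrank_span_singleton hu0

/-- For positive `T = Q²` and `A = R²` with `T` trace class, `Tr[T A] = Tr[R T R]`: both are the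
squared Hilbert–Schmidt norm of `R Q`. -/
lemma tr_comp_of_isPositive {T : TraceClass H} (hT : (T : H →L[ℂ] H).IsPositive)
    {R : H →L[ℂ] H} (hR : adjoint R = R) :
    ENNReal.ofReal (tr ((T : H →L[ℂ] H) ∘L R ∘L R)).re =
      ∑' i, ENNReal.ofReal (⟪R (onb H i), (T : H →L[ℂ] H) (R (onb H i))⟫_ℂ).re := by
  obtain ⟨W, Q, hQ, hQ2, hTQ, hW⟩ := exists_factorization T
  obtain rfl := hW hT
  have h : HasSum (fun i => ⟪Q (onb H i), (R ∘L R) (Q (onb H i))⟫_ℂ)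
      (tr ((T : H →L[ℂ] H) ∘L R ∘L R)) := by
    rw [hTQ]
    exact hasSum_tr_factorization_comp (W := 1) hQ hQ2 (R ∘L R)
  have e1 : ∀ v : H, ⟪v, (R ∘L R) v⟫_ℂ = ((‖R v‖ ^ 2 : ℝ) : ℂ) := by
    intro v
    have : ⟪v, (R ∘L R) v⟫_ℂ = ⟪R v, R v⟫_ℂ := by
      conv_rhs => rw [← adjoint_inner_right, hR]
      rfl
    rw [this, inner_self_eq_norm_sq_to_K]; simp
  have h' : HasSum (fun i => ‖R (Q (onb H i))‖ ^ 2)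
      (tr ((T : H →L[ℂ] H) ∘L R ∘L R)).re := by
    have := Complex.hasSum_re h
    simp only [e1, Complex.ofReal_re] at this
    exact this
  rw [← h'.tsum_eq, ENNReal.ofReal_tsum_of_nonneg (fun i => by positivity) h'.summable]
  have e2 : ∀ i, ⟪R (onb H i), (T : H →L[ℂ] H) (R (onb H i))⟫_ℂ =
      ⟪R (onb H i), (Q ∘L Q) (R (onb H i))⟫_ℂ := fun i => by rw [hTQ]; rfl
  simp_rw [e2, ofReal_re_inner_sq hQ, ENNReal.ofReal_pow (norm_nonneg _), ofReal_norm]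
  -- Both sides are squared Hilbert–Schmidt norms, of `R Q` and of its adjoint `Q R`.
  have := tsum_enorm_sq_adjoint (onb H) (onb H) (R ∘L Q)
  rw [adjoint_comp, hR, hQ] at this
  exact this

variable (H) in
/-- Two distinct basis vectors have distance `√2`, so the balls of radius `1 / 2` are disjoint. -/
lemma countable_basisIndex [TopologicalSpace.SeparableSpace H] : Countable (basisIndex H) := by
  have hd : ∀ i j : basisIndex H, i ≠ j → 1 ≤ dist (onb H i) (onb H j) := by
    intro i j hij
    have h0 := (onb H).orthonormal.2 hij
    have := norm_sub_sq (𝕜 := ℂ) (onb H i) (onb H j)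
    rw [h0, (onb H).orthonormal.1 i, (onb H).orthonormal.1 j, ← dist_eq_norm] at this
    norm_num at this
    nlinarith [dist_nonneg (x := onb H i) (y := onb H j)]
  refine Set.countable_univ_iff.1 (Set.PairwiseDisjoint.countable_of_isOpen
    (s := fun i : basisIndex H => Metric.ball (onb H i) (1 / 2)) ?_ (fun _ _ => Metric.isOpen_ball)
    fun i _ => ⟨onb H i, Metric.mem_ball_self (by norm_num)⟩)
  intro i _ j _ hij
  exact Metric.ball_disjoint_ball (by linarith [hd i j hij])

section Polarization

omit [CompleteSpace H]

/-- The polarization identity, as a sum over the fourth roots of unity. -/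
lemma sesquilinear_eq_sum_polarization (b : H →ₗ⋆[ℂ] H →ₗ[ℂ] ℂ) (x y : H) :
    b x y = ∑ k : Fin 4, (-Complex.I) ^ (k : ℕ) / 4 *
      b (x + Complex.I ^ (k : ℕ) • y) (x + Complex.I ^ (k : ℕ) • y) := by
  have h3 : Complex.I ^ 3 = -Complex.I := by rw [pow_succ, Complex.I_sq]; ring
  have h3' : (-Complex.I) ^ 3 = Complex.I := by rw [neg_pow, h3]; ring
  simp only [Fin.sum_univ_four, Fin.val_zero, Fin.val_one, Fin.val_two, pow_zero, pow_one,
    map_add, map_smul, map_smulₛₗ, LinearMap.add_apply, LinearMap.smul_apply, smul_eq_mul,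
    Complex.I_sq, h3, h3', neg_sq, map_neg, Complex.conj_I, map_one,
    show ((3 : Fin 4) : ℕ) = 3 from rfl]
  linear_combination (1/2 * b x y - 1/2 * b y x) * Complex.I_sq

lemma inner_eq_sum_polarization (A : H →L[ℂ] H) (x y : H) :
    ⟪x, A y⟫_ℂ = ∑ k : Fin 4, (-Complex.I) ^ (k : ℕ) / 4 *
      ⟪x + Complex.I ^ (k : ℕ) • y, A (x + Complex.I ^ (k : ℕ) • y)⟫_ℂ :=
  sesquilinear_eq_sum_polarization ((innerₛₗ ℂ).compl₂ A.toLinearMap) x y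

/-- A sesquilinear form with bounded quadratic form is bounded: polarization gives the bound on
unit vectors, and homogeneity extends it. -/
lemma norm_sesquilinear_le (b : H →ₗ⋆[ℂ] H →ₗ[ℂ] ℂ) {C : ℝ} (hC : 0 ≤ C)
    (hb : ∀ z, ‖b z z‖ ≤ C * ‖z‖ ^ 2) (x y : H) : ‖b x y‖ ≤ 4 * C * ‖x‖ * ‖y‖ := by
  have hunit : ∀ u v : H, ‖u‖ = 1 → ‖v‖ = 1 → ‖b u v‖ ≤ 4 * C := by
    intro u v hu hv
    rw [sesquilinear_eq_sum_polarization]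
    refine (norm_sum_le _ _).trans ((Finset.sum_le_card_nsmul _ _ C fun k _ => ?_).trans
      (by simp))
    have h1 : ‖u + Complex.I ^ (k : ℕ) • v‖ ≤ 2 := by
      refine (norm_add_le _ _).trans (le_of_eq ?_)
      rw [norm_smul, norm_pow, Complex.norm_I, hu, hv]
      norm_num
    have h2 : ‖(-Complex.I) ^ (k : ℕ) / 4‖ = 1 / 4 := by simp
    rw [norm_mul, h2]
    have h3 : ‖u + Complex.I ^ (k : ℕ) • v‖ ^ 2 ≤ 2 ^ 2 := by gcongr
    nlinarith [hb (u + Complex.I ^ (k : ℕ) • v), mul_le_mul_of_nonneg_left h3 hC]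
  rcases eq_or_ne x 0 with rfl | hx
  · simp
  rcases eq_or_ne y 0 with rfl | hy
  · simp
  have hx' : ‖x‖ ≠ 0 := norm_ne_zero_iff.2 hx
  have hy' : ‖y‖ ≠ 0 := norm_ne_zero_iff.2 hy
  have ex : ((‖x‖ : ℂ) • ((‖x‖ : ℂ)⁻¹ • x)) = x := by
    rw [smul_smul, mul_inv_cancel₀ (by exact_mod_cast hx'), one_smul]
  have ey : ((‖y‖ : ℂ) • ((‖y‖ : ℂ)⁻¹ • y)) = y := by
    rw [smul_smul, mul_inv_cancel₀ (by exact_mod_cast hy'), one_smul]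
  have h := hunit ((‖x‖ : ℂ)⁻¹ • x) ((‖y‖ : ℂ)⁻¹ • y)
    (by rw [norm_smul]; simp [hx']) (by rw [norm_smul]; simp [hy'])
  have e : ‖b x y‖ = ‖x‖ * ‖y‖ * ‖b ((‖x‖ : ℂ)⁻¹ • x) ((‖y‖ : ℂ)⁻¹ • y)‖ := by
    conv_lhs => rw [← ex, ← ey]
    rw [map_smul (b _), map_smulₛₗ b, LinearMap.smul_apply, norm_smul, norm_smul]
    simp only [RCLike.norm_conj, Complex.norm_real, norm_norm]
    ring
  rw [e]
  nlinarith [mul_le_mul_of_nonneg_left h (mul_nonneg (norm_nonneg x) (norm_nonneg y))]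

end Polarization

/-- Every functional `A ↦ Tr[S A]` is a linear combination of four series of expectation values
`⟪z, A z⟫` with square summable vectors `z`. -/
lemma exists_hasSum_quadratic (S : TraceClass H) : ∃ z : Fin 4 → basisIndex H → H,
    (∀ k, ∑' i, ‖z k i‖ₑ ^ 2 ≠ ∞) ∧ ∀ A : H →L[ℂ] H,
      HasSum (fun i => ∑ k : Fin 4, (-Complex.I) ^ (k : ℕ) / 4 * ⟪z k i, A (z k i)⟫_ℂ)
        (tr ((S : H →L[ℂ] H) ∘L A)) := by
  obtain ⟨W, R, hR, hR2, hS, -⟩ := exists_factorization S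
  refine ⟨fun k i => R (onb H i) + Complex.I ^ (k : ℕ) • W (R (onb H i)), fun k => ?_,
    fun A => ?_⟩
  · exact tsum_comp_left_ne_top (1 + Complex.I ^ (k : ℕ) • W) hR2
  · have h := hasSum_tr_factorization_comp (W := W) hR hR2 A
    rw [← hS] at h
    convert h using 2 with i
    exact (inner_eq_sum_polarization A (R (onb H i)) (W (R (onb H i)))).symm

end Trace

/-! ### Densities of the measures `Tr[S E(·)]` -/

section Densities

variable {G : Type*} [MeasurableSpace G]
variable {H : Type*} [NormedAddCommGroup H] [InnerProductSpace ℂ H]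

open ContinuousLinearMap

lemma _root_.MeasureTheory.MemLp.exists_ae_norm_le {lam : Measure G} {f : G → ℂ}
    (hf : MemLp f ∞ lam) : ∃ C : ℝ, 0 ≤ C ∧ ∀ᵐ x ∂lam, ‖f x‖ ≤ C := by
  refine ⟨(eLpNorm f ∞ lam).toReal, ENNReal.toReal_nonneg, ?_⟩
  filter_upwards [ae_le_eLpNormEssSup (f := f) (μ := lam)] with x hx
  rw [← eLpNorm_exponent_top] at hx
  rw [← toReal_enorm]
  exact ENNReal.toReal_mono hf.2.ne hx

namespace Observable

variable (E : Observable G H)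

lemma apply_empty : E ∅ = 0 := by
  ext y
  refine ext_inner_left ℂ fun x => ?_
  have h := E.countably_additive (fun _ => ∅) (fun _ => MeasurableSet.empty)
    (fun i j _ => by simp [Function.onFun]) x y
  simpa using (summable_const_iff _).1 h.summable

lemma re_inner_nonneg {B : Set G} (hB : MeasurableSet B) (z : H) : 0 ≤ (⟪z, E B z⟫_ℂ).re :=
  (E.positive B hB).re_inner_nonneg_right z

lemma ofReal_re_inner {B : Set G} (hB : MeasurableSet B) (z : H) :
    (((⟪z, E B z⟫_ℂ).re : ℝ) : ℂ) = ⟪z, E B z⟫_ℂ :=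
  (Complex.eq_re_of_ofReal_le (r := 0)
    (by simpa using! (E.positive B hB).inner_nonneg_right z)).symm

/-- The finite positive measure `B ↦ ⟪z, E(B) z⟫`. -/
noncomputable def quadMeasure (z : H) : Measure G :=
  Measure.ofMeasurable (fun B _ => ENNReal.ofReal (⟪z, E B z⟫_ℂ).re)
    (by simp [E.apply_empty]) (by
      intro B hB hd
      have h := Complex.hasSum_re (E.countably_additive B hB hd z z)
      rw [← h.tsum_eq, ENNReal.ofReal_tsum_of_nonneg
        (fun i => E.re_inner_nonneg (hB i) z) h.summable])

lemma quadMeasure_apply {B : Set G} (hB : MeasurableSet B) (z : H) :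
    E.quadMeasure z B = ENNReal.ofReal (⟪z, E B z⟫_ℂ).re :=
  Measure.ofMeasurable_apply B hB

lemma quadMeasure_univ (z : H) : E.quadMeasure z univ = ‖z‖ₑ ^ 2 := by
  rw [E.quadMeasure_apply MeasurableSet.univ, E.normalized,
    show (1 : H →L[ℂ] H) z = z from rfl, inner_self_eq_norm_sq_to_K,
    ← ofReal_norm, ← ENNReal.ofReal_pow (norm_nonneg _)]
  norm_cast

instance (z : H) : IsFiniteMeasure (E.quadMeasure z) :=
  ⟨by rw [quadMeasure_univ]; finiteness⟩

lemma coe_quadMeasure_real {B : Set G} (hB : MeasurableSet B) (z : H) :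
    (((E.quadMeasure z).real B : ℝ) : ℂ) = ⟪z, E B z⟫_ℂ := by
  rw [measureReal_def, E.quadMeasure_apply hB, ENNReal.toReal_ofReal (E.re_inner_nonneg hB z),
    E.ofReal_re_inner hB]

variable {E} {lam : Measure G} [CompleteSpace H]

lemma IsAbsCont.quadMeasure_ac (hE : E.IsAbsCont lam) (z : H) : E.quadMeasure z ≪ lam := by
  refine Measure.AbsolutelyContinuous.mk fun B hB h0 => ?_
  have := hE (rankOneTC z z) B hB h0
  rw [tr_rankOneTC_comp] at this
  rw [E.quadMeasure_apply hB, this]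
  simp

/-- The measure `B ↦ Tr[S E(B)]` has a density with respect to `lam`, because it is a
combination of four finite sums of measures `E.quadMeasure z`. Such a density computes `Tr[S A]`
for every operator `A` with the expectation values of the integral of a bounded function `f`. -/
lemma IsAbsCont.exists_density [SigmaFinite lam] (hE : E.IsAbsCont lam) (S : TraceClass H) :
    ∃ h : G → ℂ, Integrable h lam ∧ ∀ f : G → ℂ, MemLp f ∞ lam → ∀ A : H →L[ℂ] H,
      (∀ z, ∫ x, f x ∂(E.quadMeasure z) = ⟪z, A z⟫_ℂ) →
        tr ((S : H →L[ℂ] H) ∘L A) = ∫ x, h x * f x ∂lam := by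
  obtain ⟨z, hz, hS⟩ := exists_hasSum_quadratic S
  let ν : Fin 4 → Measure G := fun k => Measure.sum fun i => E.quadMeasure (z k i)
  have hfin : ∀ k, IsFiniteMeasure (ν k) := fun k => ⟨by
    rw [Measure.sum_apply _ MeasurableSet.univ]
    simp_rw [quadMeasure_univ]
    exact (hz k).lt_top⟩
  have hac : ∀ k, ν k ≪ lam := fun k =>
    Measure.absolutelyContinuous_sum_left fun i => hE.quadMeasure_ac _
  refine ⟨fun x => ∑ k : Fin 4, (-Complex.I) ^ (k : ℕ) / 4 * (((ν k).rnDeriv lam x).toReal : ℂ),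
    integrable_finsetSum _ fun k _ => (Measure.integrable_toReal_rnDeriv.ofReal).const_mul _,
    fun f hf A hA => ?_⟩
  obtain ⟨C, -, hC⟩ := hf.exists_ae_norm_le
  have hfi : ∀ k, Integrable f (ν k) := fun k =>
    Integrable.of_bound (hf.1.mono_ac (hac k)) C ((hac k).ae_le hC)
  have h1 : HasSum (fun i => ∑ k : Fin 4, (-Complex.I) ^ (k : ℕ) / 4 * ⟪z k i, A (z k i)⟫_ℂ)
      (∑ k : Fin 4, (-Complex.I) ^ (k : ℕ) / 4 * ∫ x, f x ∂(ν k)) := by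
    refine hasSum_sum fun k _ => HasSum.mul_left _ ?_
    simp_rw [← hA]
    exact hasSum_integral_measure (hfi k)
  rw [(hS A).unique h1]
  simp_rw [Finset.sum_mul, mul_assoc]
  rw [integral_finsetSum]
  · refine Finset.sum_congr rfl fun k _ => ?_
    rw [integral_const_mul, ← integral_rnDeriv_smul (hac k)]
    simp_rw [Complex.real_smul]
  · intro k _
    refine Integrable.const_mul ?_ _
    have := (integrable_rnDeriv_smul_iff (hac k)).2 (hfi k)
    simpa only [Complex.real_smul] using this

variable [SigmaFinite lam]

/-- A density with respect to `lam` of the complex measure `B ↦ Tr[S E(B)]`, chosen for each `S`;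
as it is unique up to null sets, it is almost everywhere linear in `S`. -/
noncomputable def IsAbsCont.density (hE : E.IsAbsCont lam) (S : TraceClass H) : G → ℂ :=
  (hE.exists_density S).choose

section

variable (hE : E.IsAbsCont lam)

lemma IsAbsCont.integrable_density (S : TraceClass H) : Integrable (hE.density S) lam :=
  (hE.exists_density S).choose_spec.1

lemma IsAbsCont.tr_comp_eq_integral_density (S : TraceClass H) {f : G → ℂ}
    (hf : MemLp f ∞ lam) {A : H →L[ℂ] H}
    (hA : ∀ z, ∫ x, f x ∂(E.quadMeasure z) = ⟪z, A z⟫_ℂ) :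
    tr ((S : H →L[ℂ] H) ∘L A) = ∫ x, hE.density S x * f x ∂lam :=
  (hE.exists_density S).choose_spec.2 f hf A hA

lemma IsAbsCont.setIntegral_density (S : TraceClass H) {B : Set G} (hB : MeasurableSet B) :
    ∫ x in B, hE.density S x ∂lam = tr ((S : H →L[ℂ] H) ∘L E B) := by
  have hf : MemLp (B.indicator fun _ => (1 : ℂ)) ∞ lam := (memLp_top_const 1).indicator hB
  rw [hE.tr_comp_eq_integral_density S hf, ← integral_indicator hB]
  · congr 1
    ext x
    by_cases hx : x ∈ B <;> simp [hx]
  · intro z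
    rw [integral_indicator_const _ hB, ← E.coe_quadMeasure_real hB z]
    simp

lemma IsAbsCont.density_ae_eq {S : TraceClass H} {h : G → ℂ} (hh : Integrable h lam)
    (hS : ∀ B, MeasurableSet B → ∫ x in B, h x ∂lam = tr ((S : H →L[ℂ] H) ∘L E B)) :
    hE.density S =ᵐ[lam] h :=
  (hE.integrable_density S).ae_eq_of_forall_setIntegral_eq _ _ hh fun B hB _ => by
    rw [hE.setIntegral_density S hB, hS B hB]

lemma IsAbsCont.integrable_density_mul (S : TraceClass H) {f : G → ℂ} (hf : MemLp f ∞ lam) :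
    Integrable (fun x => hE.density S x * f x) lam := by
  obtain ⟨C, -, hC⟩ := hf.exists_ae_norm_le
  exact (hE.integrable_density S).mul_bdd hf.1 hC

lemma IsAbsCont.density_add (S T : TraceClass H) :
    hE.density (S + T) =ᵐ[lam] hE.density S + hE.density T := by
  refine hE.density_ae_eq ((hE.integrable_density S).add (hE.integrable_density T))
    fun B hB => ?_
  rw [tr_add_comp, ← hE.setIntegral_density S hB, ← hE.setIntegral_density T hB]
  exact integral_add (hE.integrable_density S).integrableOn (hE.integrable_density T).integrableOn

lemma IsAbsCont.density_smul (c : ℂ) (S : TraceClass H) :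
    hE.density (c • S) =ᵐ[lam] c • hE.density S := by
  refine hE.density_ae_eq ((hE.integrable_density S).smul c) fun B hB => ?_
  rw [tr_smul_comp, ← hE.setIntegral_density S hB]
  exact integral_const_mul c _

/-- The linear functional `S ↦ ∫ f d(Tr[S E(·)])` on the trace class. -/
noncomputable def IsAbsCont.integralFunctional {f : G → ℂ} (hf : MemLp f ∞ lam) :
    TraceClass H →ₗ[ℂ] ℂ where
  toFun S := ∫ x, hE.density S x * f x ∂lam
  map_add' S T := by
    rw [← integral_add (hE.integrable_density_mul S hf) (hE.integrable_density_mul T hf)]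
    refine integral_congr_ae ?_
    filter_upwards [hE.density_add S T] with x hx
    rw [hx, Pi.add_apply, add_mul]
  map_smul' c S := by
    rw [RingHom.id_apply, smul_eq_mul, ← integral_const_mul]
    refine integral_congr_ae ?_
    filter_upwards [hE.density_smul c S] with x hx
    rw [hx, Pi.smul_apply, smul_eq_mul, mul_assoc]

/-- For a positive rank one operator, the density is the Radon–Nikodym derivative of the positive
measure `E.quadMeasure z`, so that it computes the integral of every function. -/
lemma IsAbsCont.integral_quadMeasure_eq (f : G → ℂ) (z : H) :
    ∫ x, f x ∂(E.quadMeasure z) = ∫ x, hE.density (rankOneTC z z) x * f x ∂lam := by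
  have hac := hE.quadMeasure_ac z
  rw [← integral_rnDeriv_smul hac]
  have : hE.density (rankOneTC z z) =ᵐ[lam]
      fun x => (((E.quadMeasure z).rnDeriv lam x).toReal : ℂ) := by
    refine hE.density_ae_eq Measure.integrable_toReal_rnDeriv.ofReal fun B hB => ?_
    rw [tr_rankOneTC_comp, ← E.coe_quadMeasure_real hB, integral_complex_ofReal,
      Measure.setIntegral_toReal_rnDeriv hac]
  refine integral_congr_ae ?_
  filter_upwards [this] with x hx
  rw [hx, Complex.real_smul]

end

end Observable

end Densities

/-! ### Integration against a complex measure with a density -/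

section VectorMeasureIntegral

variable {G : Type*} [MeasurableSpace G] {lam : Measure G} {h f : G → ℂ}

lemma integrable_mul_of_integrable_withDensity (hh : Integrable h lam)
    (hf : Integrable f (lam.withDensity fun x => ‖h x‖ₑ)) :
    Integrable (fun x => h x * f x) lam := by
  have h1 := (integrable_withDensity_iff_integrable_smul₀' hh.aestronglyMeasurable.enorm
    (Filter.Eventually.of_forall fun x => enorm_lt_top)).1 hf
  simp only [toReal_enorm] at h1
  -- `f` need not be measurable for `lam` where `h` vanishes, so the phase of `h` is factored out.
  have h2 : AEStronglyMeasurable (fun x => ‖h x‖⁻¹ • h x) lam :=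
    hh.aestronglyMeasurable.norm.inv₀.smul hh.aestronglyMeasurable
  have h3 : ∀ x, ‖‖h x‖⁻¹ • h x‖ ≤ 1 := fun x => by simp [inv_mul_le_one]
  refine (h1.bdd_mul h2 (Filter.Eventually.of_forall h3)).congr
    (Filter.Eventually.of_forall fun x => ?_)
  rcases eq_or_ne (h x) 0 with hx | hx
  · simp [hx]
  · have : (‖h x‖ : ℂ) ≠ 0 := by simpa using hx
    simp only [Complex.real_smul, Complex.ofReal_inv]
    field_simp

/-- Integration against the complex measure with density `h` is integration of the product
with `h`. -/
lemma integral_withDensityᵥ (hh : Integrable h lam)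
    (hf : Integrable f (lam.withDensityᵥ h).variation) :
    (lam.withDensityᵥ h).integral f (ContinuousLinearMap.mul ℝ ℂ) = ∫ x, h x * f x ∂lam := by
  have hv := Measure.variation_withDensityᵥ hh
  have hvi : ∀ φ : G → ℝ, ∫ x, φ x ∂(lam.withDensityᵥ h).variation =
      ∫ x, φ x ∂(lam.withDensity fun x => ‖h x‖ₑ) := fun φ => by rw [hv]
  have hint : ∀ {g : G → ℂ}, Integrable g (lam.withDensityᵥ h).variation →
      Integrable (fun x => h x * g x) lam := fun {g} hg =>
    integrable_mul_of_integrable_withDensity hh (hv ▸ hg)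
  refine Integrable.induction (P := fun f => (lam.withDensityᵥ h).integral f
    (ContinuousLinearMap.mul ℝ ℂ) = ∫ x, h x * f x ∂lam) ?_ ?_ ?_ ?_ hf
  · intro c s hs hfin
    rw [VectorMeasure.integral_eq_setToFun, setToFun_indicator_const _ hs hfin.ne,
      transpose_eq_cbmApplyMeasure, cbmApplyMeasure_apply,
      ContinuousLinearMap.mul_apply', withDensityᵥ_apply hh hs, ← integral_const_mul,
      ← integral_indicator hs]
    congr 1
    ext x
    by_cases hx : x ∈ s <;> simp [hx, mul_comm]
  · intro f g _ hf hg ihf ihg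
    rw [VectorMeasure.integral_add hf hg, ihf, ihg, ← integral_add (hint hf) (hint hg)]
    simp only [Pi.add_apply, mul_add]
  · -- The variation has density `‖h‖`, so `g ↦ ∫ h g` is `1`-Lipschitz on its `L¹` space.
    refine isClosed_eq VectorMeasure.continuous_integral ?_
    refine LipschitzWith.continuous (K := 1) (LipschitzWith.of_dist_le_mul fun g₁ g₂ => ?_)
    have i₁ := hint (L1.integrable_coeFn g₁)
    have i₂ := hint (L1.integrable_coeFn g₂)
    rw [NNReal.coe_one, one_mul, dist_eq_norm, ← integral_sub i₁ i₂, L1.dist_eq_integral_dist,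
      hvi, integral_withDensity_eq_integral_toReal_smul₀
        hh.aestronglyMeasurable.enorm (Filter.Eventually.of_forall fun x => enorm_lt_top)]
    refine (norm_integral_le_integral_norm _).trans (le_of_eq ?_)
    congr 1
    ext x
    rw [← mul_sub, norm_mul, toReal_enorm, smul_eq_mul, dist_eq_norm]
  · intro f g hfg _ ih
    rw [← VectorMeasure.integral_congr_ae hfg, ih]
    rw [hv, Filter.EventuallyEq, ae_withDensity_iff' hh.aestronglyMeasurable.enorm] at hfg
    refine integral_congr_ae ?_
    filter_upwards [hfg] with x hx
    rcases eq_or_ne (h x) 0 with h0 | h0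
    · simp [h0]
    · rw [hx (by simpa using h0)]

end VectorMeasureIntegral

/-! ### The operator integral -/

section OperatorIntegral

variable {G : Type*} [MeasurableSpace G]
variable {H : Type*} [NormedAddCommGroup H] [InnerProductSpace ℂ H] [CompleteSpace H]
variable {E : Observable G H} {lam : Measure G} [SigmaFinite lam] (hE : E.IsAbsCont lam)

open ContinuousLinearMap InnerProductSpace

namespace Observable

/-- The sesquilinear form `(x, y) ↦ ∫ f d⟪x, E(·) y⟫`. -/
noncomputable def IsAbsCont.integralForm {f : G → ℂ} (hf : MemLp f ∞ lam) : H →ₗ⋆[ℂ] H →ₗ[ℂ] ℂ :=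
  LinearMap.mk₂'ₛₗ (starRingEnd ℂ) (RingHom.id ℂ)
    (fun x y => hE.integralFunctional hf (rankOneTC x y))
    (fun x x' y => by rw [rankOneTC_add_left, map_add])
    (fun c x y => by rw [rankOneTC_smul_left, map_smul])
    (fun x y y' => by rw [rankOneTC_add_right, map_add])
    (fun c x y => by rw [rankOneTC_smul_right, map_smul]; rfl)

lemma IsAbsCont.integralForm_self {f : G → ℂ} (hf : MemLp f ∞ lam) (z : H) :
    hE.integralForm hf z z = ∫ x, f x ∂(E.quadMeasure z) :=
  (hE.integral_quadMeasure_eq f z).symm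

lemma IsAbsCont.exists_norm_integralForm_le {f : G → ℂ} (hf : MemLp f ∞ lam) :
    ∃ C : ℝ, ∀ x y : H, ‖hE.integralForm hf x y‖ ≤ C * ‖x‖ * ‖y‖ := by
  obtain ⟨C, hC0, hC⟩ := hf.exists_ae_norm_le
  refine ⟨4 * C, norm_sesquilinear_le _ hC0 fun z => ?_⟩
  rw [hE.integralForm_self]
  refine (norm_integral_le_of_norm_le_const ((hE.quadMeasure_ac z).ae_le hC)).trans (le_of_eq ?_)
  rw [measureReal_def, E.quadMeasure_univ]
  simp

/-- The operator integral of a bounded function exists. -/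
lemma IsAbsCont.exists_operator {f : G → ℂ} (hf : MemLp f ∞ lam) : ∃ A : H →L[ℂ] H,
    ∀ S : TraceClass H, tr ((S : H →L[ℂ] H) ∘L A) = ∫ x, hE.density S x * f x ∂lam := by
  obtain ⟨C, hC⟩ := hE.exists_norm_integralForm_le hf
  refine ⟨adjoint (continuousLinearMapOfBilin ((hE.integralForm hf).mkContinuous₂ C hC)),
    fun S => hE.tr_comp_eq_integral_density S hf fun z => ?_⟩
  rw [adjoint_inner_right, continuousLinearMapOfBilin_apply, ← hE.integralForm_self hf]
  rfl

/-- The operator integral `f ↦ ∫ f dE` of essentially bounded functions: the operator whose pairing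
with each trace class `S` is the integral of `f` against the density of `Tr[S E(·)]`. -/
noncomputable def IsAbsCont.operatorIntegral : Lp ℂ ∞ lam →ₗ[ℂ] (H →L[ℂ] H) where
  toFun f := (hE.exists_operator (Lp.memLp f)).choose
  map_add' f g := by
    refine eq_of_forall_tr_comp_eq fun S => ?_
    rw [(hE.exists_operator (Lp.memLp (f + g))).choose_spec S, tr_comp_add,
      (hE.exists_operator (Lp.memLp f)).choose_spec S,
      (hE.exists_operator (Lp.memLp g)).choose_spec S,
      ← integral_add (hE.integrable_density_mul S (Lp.memLp f))
        (hE.integrable_density_mul S (Lp.memLp g))]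
    refine integral_congr_ae ?_
    filter_upwards [Lp.coeFn_add f g] with x hx
    rw [hx, Pi.add_apply, mul_add]
  map_smul' c f := by
    refine eq_of_forall_tr_comp_eq fun S => ?_
    rw [(hE.exists_operator (Lp.memLp (c • f))).choose_spec S, RingHom.id_apply, tr_comp_smul,
      (hE.exists_operator (Lp.memLp f)).choose_spec S, ← integral_const_mul]
    refine integral_congr_ae ?_
    filter_upwards [Lp.coeFn_smul c f] with x hx
    rw [hx, Pi.smul_apply, smul_eq_mul, mul_left_comm]

lemma IsAbsCont.tr_comp_operatorIntegral (S : TraceClass H) (f : Lp ℂ ∞ lam) :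
    tr ((S : H →L[ℂ] H) ∘L hE.operatorIntegral f) = ∫ x, hE.density S x * f x ∂lam :=
  (hE.exists_operator (Lp.memLp f)).choose_spec S

lemma IsAbsCont.inner_operatorIntegral (f : Lp ℂ ∞ lam) (z : H) :
    ⟪z, hE.operatorIntegral f z⟫_ℂ = ∫ x, f x ∂(E.quadMeasure z) := by
  rw [← tr_rankOneTC_comp, hE.tr_comp_operatorIntegral, hE.integral_quadMeasure_eq]

/-- The operator integral is the unique ultraweak integral of any representative of `F`: the measure
`Tr[S E(·)]` is the one with density `hE.density S`, and the pairing separates operators. -/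
lemma IsAbsCont.hasIntegral_iff (F : Lp ℂ ∞ lam) {f : G → ℂ} (hfF : f =ᵐ[lam] F)
    (A : H →L[ℂ] H) : E.HasIntegral f A ↔ A = hE.operatorIntegral F := by
  have hf : MemLp f ∞ lam := (memLp_congr_ae hfF).2 (Lp.memLp F)
  obtain ⟨C, -, hC⟩ := hf.exists_ae_norm_le
  have hμ : ∀ (S : TraceClass H) B, MeasurableSet B →
      lam.withDensityᵥ (hE.density S) B = tr ((S : H →L[ℂ] H) ∘L E B) := fun S B hB => by
    rw [withDensityᵥ_apply (hE.integrable_density S) hB, hE.setIntegral_density S hB]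
  have hfi : ∀ S : TraceClass H, Integrable f (lam.withDensityᵥ (hE.density S)).variation := by
    intro S
    rw [Measure.variation_withDensityᵥ (hE.integrable_density S)]
    have : IsFiniteMeasure (lam.withDensity fun x => ‖hE.density S x‖ₑ) :=
      isFiniteMeasure_withDensity (hE.integrable_density S).2.ne
    have hac := withDensity_absolutelyContinuous lam fun x => ‖hE.density S x‖ₑ
    exact Integrable.of_bound (hf.1.mono_ac hac) C (hac.ae_le hC)
  have hval : ∀ S : TraceClass H, (lam.withDensityᵥ (hE.density S)).integral f
      (ContinuousLinearMap.mul ℝ ℂ) = tr ((S : H →L[ℂ] H) ∘L hE.operatorIntegral F) := by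
    intro S
    rw [integral_withDensityᵥ (hE.integrable_density S) (hfi S), hE.tr_comp_operatorIntegral]
    refine integral_congr_ae ?_
    filter_upwards [hfF] with x hx
    rw [hx]
  constructor
  · intro hA
    refine eq_of_forall_tr_comp_eq fun S => ?_
    obtain ⟨μ, h1, -, h3⟩ := hA S
    have : μ = lam.withDensityᵥ (hE.density S) :=
      VectorMeasure.ext fun B hB => by rw [h1 B hB, hμ S B hB]
    rw [h3, this, hval]
  · rintro rfl S
    exact ⟨_, hμ S, hfi S, (hval S).symm⟩

lemma IsAbsCont.isNormalMap_operatorIntegral : IsNormalMap lam hE.operatorIntegral := by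
  unfold IsNormalMap
  rw [continuous_induced_rng]
  let _ := weakStarTopology lam
  refine continuous_pi fun S => ?_
  have h1 : Continuous fun f : Lp ℂ ∞ lam => fun h : Lp ℂ 1 lam => ∫ x, h x * f x ∂lam :=
    continuous_induced_dom
  refine ((continuous_apply ((memLp_one_iff_integrable.2 (hE.integrable_density S)).toLp _)).comp
    h1).congr fun f => ?_
  change _ = tr ((S : H →L[ℂ] H) ∘L hE.operatorIntegral f)
  rw [hE.tr_comp_operatorIntegral]
  refine integral_congr_ae ?_
  filter_upwards [(memLp_one_iff_integrable.2 (hE.integrable_density S)).coeFn_toLp] with x hx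
  rw [hx]

lemma IsAbsCont.isPositiveMap_operatorIntegral : IsPositiveMap lam hE.operatorIntegral := by
  intro f hf
  rw [isPositive_iff_complex]
  intro z
  have h0 : 0 ≤ ⟪z, hE.operatorIntegral f z⟫_ℂ := by
    rw [hE.inner_operatorIntegral]
    exact integral_nonneg_of_ae ((hE.quadMeasure_ac z).ae_le hf)
  have h1 : 0 ≤ ⟪hE.operatorIntegral f z, z⟫_ℂ := by
    rw [← inner_conj_symm]
    exact star_nonneg_iff.2 h0
  exact ⟨RCLike.ext (by simp) (by simp [(Complex.nonneg_iff.1 h1).2.symm]),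
    (Complex.nonneg_iff.1 h1).1⟩

lemma IsAbsCont.operatorIntegral_one :
    hE.operatorIntegral ((memLp_top_const (1 : ℂ)).toLp (fun _ => 1)) = 1 := by
  refine eq_of_forall_tr_comp_eq fun S => ?_
  rw [hE.tr_comp_operatorIntegral, ← E.normalized, ← hE.setIntegral_density S MeasurableSet.univ,
    setIntegral_univ]
  refine integral_congr_ae ?_
  filter_upwards [(memLp_top_const (μ := lam) (1 : ℂ)).coeFn_toLp] with x hx
  rw [hx, mul_one]

end Observable

end OperatorIntegral

section Covariance

variable {G : Type*} [Group G] [TopologicalSpace G] [IsTopologicalGroup G] [MeasurableSpace G]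
  [BorelSpace G]
variable {H : Type*} [NormedAddCommGroup H] [InnerProductSpace ℂ H] [CompleteSpace H]
variable {E : Observable G H} {lam : Measure G} [SigmaFinite lam] [lam.IsMulLeftInvariant]

/-- Covariance of `E` says that the density of `β(g) S` is the left translate of that of `S`. -/
lemma Observable.IsAbsCont.isCovariantMap_operatorIntegral (hE : E.IsAbsCont lam)
    {β : G →* (TraceClass H ≃ₗ[ℂ] TraceClass H)} (hcov : E.IsCovariant β) :
    IsCovariantMap lam β hE.operatorIntegral := by
  intro g f S
  have hmp := measurePreserving_mul_left lam g
  have hemb : MeasurableEmbedding fun x : G => g * x :=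
    (MeasurableEquiv.mulLeft g).measurableEmbedding
  have hdens : hE.density S =ᵐ[lam] fun x => hE.density (β g S) (g * x) := by
    refine hE.density_ae_eq (hmp.integrable_comp_of_integrable (hE.integrable_density _))
      fun B hB => ?_
    have hgB : MeasurableSet (g • B) := hB.const_smul g
    have e := hcov g (g • B) hgB S
    rw [inv_smul_smul] at e
    rw [e, ← hE.setIntegral_density _ hgB,
      ← hmp.setIntegral_preimage_emb hemb (hE.density (β g S)) (g • B)]
    congr 2
    ext x
    simp [Set.mem_smul_set_iff_inv_smul_mem]
  rw [hE.tr_comp_operatorIntegral, hE.tr_comp_operatorIntegral,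
    ← hmp.integral_comp hemb fun x => hE.density (β g S) x * f x]
  refine integral_congr_ae ?_
  filter_upwards [hdens, Lp.coeFn_compMeasurePreserving f hmp] with x h1 h2
  rw [h1, h2, Function.comp_apply]

end Covariance

/-! ### The trace of a covariant observable -/

section PhaseSpace

variable {G : Type*} [Group G] [TopologicalSpace G] [MeasurableSpace G] [BorelSpace G]
variable {H : Type*} [NormedAddCommGroup H] [InnerProductSpace ℂ H] [CompleteSpace H]
variable {lam : Measure G} {β : G →* (TraceClass H ≃ₗ[ℂ] TraceClass H)} {d : ℝ}

open ContinuousLinearMap InnerProductSpace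

omit [BorelSpace G] in
lemma IsPhaseSpaceSystem.isPositive_apply_rankOneTC (hβ : IsPhaseSpaceSystem lam β d) (φ : H)
    (g : G) : (β g (rankOneTC φ φ) : H →L[ℂ] H).IsPositive :=
  (hβ.aut g).positive _ (isPositive_rankOne_self φ)

lemma IsPhaseSpaceSystem.measurable_expectation (hβ : IsPhaseSpaceSystem lam β d) (S : TraceClass H)
    (v : H) : Measurable fun g => ENNReal.ofReal (⟪v, (β g S : H →L[ℂ] H) v⟫_ℂ).re := by
  have h := hβ.continuous (rankOneTC v v) S
  simp_rw [tr_rankOneTC_comp] at h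
  exact (Complex.continuous_re.comp h).measurable.ennreal_ofReal

/-- The orthogonality relation with an arbitrary vector `v` in place of a unit vector. -/
lemma IsPhaseSpaceSystem.lintegral_expectation (hβ : IsPhaseSpaceSystem lam β d) {φ : H}
    (hφ : ‖φ‖ = 1) (v : H) :
    ∫⁻ g, ENNReal.ofReal (⟪v, (β g (rankOneTC φ φ) : H →L[ℂ] H) v⟫_ℂ).re ∂lam =
      ENNReal.ofReal d * ‖v‖ₑ ^ 2 := by
  have hunit : ∀ u : H, ‖u‖ = 1 →
      ∫⁻ g, ENNReal.ofReal (⟪u, (β g (rankOneTC φ φ) : H →L[ℂ] H) u⟫_ℂ).re ∂lam =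
        ENNReal.ofReal d := by
    intro u hu
    have h := hβ.integral_eq (rankOneTC u u) (rankOneTC φ φ) (rankOneTC_isOneDimProjection hu)
      (rankOneTC_isOneDimProjection hφ)
    simp_rw [tr_rankOneTC_comp] at h
    -- A non-integrable function has Bochner integral `0`, which differs from `d`.
    have hi : Integrable (fun g => ⟪u, (β g (rankOneTC φ φ) : H →L[ℂ] H) u⟫_ℂ) lam := by
      by_contra hn
      rw [integral_undef hn] at h
      exact hβ.d_pos.ne (by exact_mod_cast h)
    have hl := ofReal_integral_eq_lintegral_ofReal hi.re
      (Filter.Eventually.of_forall fun g =>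
        (hβ.isPositive_apply_rankOneTC φ g).re_inner_nonneg_right u)
    have hre := integral_re hi
    rw [h] at hre
    exact hl.symm.trans (congrArg ENNReal.ofReal (hre.trans (Complex.ofReal_re d)))
  rcases eq_or_ne v 0 with rfl | hv
  · simp
  have hv' : (‖v‖ : ℂ) ≠ 0 := by simpa using hv
  set u : H := (‖v‖ : ℂ)⁻¹ • v with hu
  have hvu : v = (‖v‖ : ℂ) • u := by rw [hu, smul_smul, mul_inv_cancel₀ hv', one_smul]
  have e : ∀ g, ENNReal.ofReal (⟪v, (β g (rankOneTC φ φ) : H →L[ℂ] H) v⟫_ℂ).re =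
      ENNReal.ofReal (⟪u, (β g (rankOneTC φ φ) : H →L[ℂ] H) u⟫_ℂ).re * ‖v‖ₑ ^ 2 := by
    intro g
    have e1 : (⟪v, (β g (rankOneTC φ φ) : H →L[ℂ] H) v⟫_ℂ).re =
        (⟪u, (β g (rankOneTC φ φ) : H →L[ℂ] H) u⟫_ℂ).re * ‖v‖ ^ 2 := by
      conv_lhs => rw [hvu]
      rw [map_smul, inner_smul_left, inner_smul_right, Complex.conj_ofReal,
        Complex.re_ofReal_mul, Complex.re_ofReal_mul]
      ring
    rw [e1, ENNReal.ofReal_mul' (by positivity), ENNReal.ofReal_pow (norm_nonneg _), ofReal_norm]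
  simp_rw [e]
  rw [lintegral_mul_const _ (hβ.measurable_expectation _ _), hunit u]
  rw [hu, norm_smul]
  simp [hv]

/-- Integrated over the group, the expectation of a positive operator `A` in the states
`β(g) |φ⟩⟨φ|` is `d Tr A`. -/
lemma IsPhaseSpaceSystem.lintegral_tr_comp [TopologicalSpace.SeparableSpace H]
    (hβ : IsPhaseSpaceSystem lam β d) {φ : H} (hφ : ‖φ‖ = 1) {A : H →L[ℂ] H}
    (hA : A.IsPositive) :
    ∫⁻ g, ENNReal.ofReal (tr ((β g (rankOneTC φ φ) : H →L[ℂ] H) ∘L A)).re ∂lam =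
      ENNReal.ofReal d * posTrace A := by
  obtain ⟨R, hR, rfl⟩ := exists_sqrt ((nonneg_iff_isPositive A).2 hA)
  have := countable_basisIndex H
  simp_rw [fun g => tr_comp_of_isPositive (hβ.isPositive_apply_rankOneTC φ g) hR]
  rw [lintegral_tsum fun i => (hβ.measurable_expectation _ _).aemeasurable]
  simp_rw [hβ.lintegral_expectation hφ]
  rw [ENNReal.tsum_mul_left]
  unfold posTrace
  simp_rw [ofReal_re_inner_sq hR]

lemma eq_zero_of_posTrace_eq_zero {A : H →L[ℂ] H} (hA : A.IsPositive) (h : posTrace A = 0) :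
    A = 0 := by
  obtain ⟨R, hR, rfl⟩ := exists_sqrt ((nonneg_iff_isPositive A).2 hA)
  have h0 : ∀ x, R x = 0 := by
    intro x
    have hb : ∀ i, R (onb H i) = 0 := fun i => by
      have := ENNReal.tsum_eq_zero.1 h i
      rw [ofReal_re_inner_sq hR] at this
      simpa using this
    have := ((onb H).hasSum_repr x).mapL R
    simp only [map_smul, hb, smul_zero] at this
    exact this.unique hasSum_zero
  ext x
  simp [h0]

/-- For a unimodular group, the average of `m(g⁻¹ B)` over `g` is the Haar measure of `B` times the
mass of `m`. -/
lemma lintegral_measure_inv_smul [IsTopologicalGroup G] [SecondCountableTopology G]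
    [SigmaFinite lam] [lam.IsMulRightInvariant] (m : Measure G) [SFinite m] {B : Set G}
    (hB : MeasurableSet B) : ∫⁻ g, m (g⁻¹ • B) ∂lam = lam B * m univ := by
  have hm : Measurable (B.indicator (1 : G → ℝ≥0∞)) := measurable_one.indicator hB
  have e : ∀ g, m (g⁻¹ • B) = ∫⁻ x, B.indicator 1 (g * x) ∂m := by
    intro g
    rw [← lintegral_indicator_one (hB.const_smul g⁻¹)]
    congr 1
    ext x
    by_cases hx : g * x ∈ B <;> simp [Set.indicator, Set.mem_smul_set_iff_inv_smul_mem, hx]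
  simp_rw [e]
  rw [lintegral_lintegral_swap (f := fun g x => B.indicator (1 : G → ℝ≥0∞) (g * x))
    (hm.comp measurable_mul).aemeasurable]
  simp_rw [lintegral_mul_right_eq_self (μ := lam) (B.indicator (1 : G → ℝ≥0∞)),
    lintegral_indicator_one hB, lintegral_const]

variable {E : Observable G H} [IsTopologicalGroup G] [SecondCountableTopology G] [SigmaFinite lam]
  [lam.IsMulRightInvariant] [TopologicalSpace.SeparableSpace H]

lemma Observable.IsCovariant.posTrace_eq [Nontrivial H] (hE : E.IsCovariant β)
    (hβ : IsPhaseSpaceSystem lam β d) {B : Set G} (hB : MeasurableSet B) :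
    posTrace (E B) = (ENNReal.ofReal d)⁻¹ * lam B := by
  obtain ⟨φ, hφ⟩ := exists_norm_eq H (zero_le_one (α := ℝ))
  have h1 := hβ.lintegral_tr_comp hφ (E.positive B hB)
  have h2 : ∀ g, ENNReal.ofReal (tr ((β g (rankOneTC φ φ) : H →L[ℂ] H) ∘L E B)).re =
      E.quadMeasure φ (g⁻¹ • B) := fun g => by
    rw [← hE g B hB, tr_rankOneTC_comp, E.quadMeasure_apply (hB.const_smul _)]
  simp_rw [h2] at h1
  rw [lintegral_measure_inv_smul _ hB, E.quadMeasure_univ, ← ofReal_norm, hφ] at h1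
  simp only [ENNReal.ofReal_one, one_pow, mul_one] at h1
  rw [h1, ← mul_assoc, ENNReal.inv_mul_cancel (by simpa using hβ.d_pos) ENNReal.ofReal_ne_top,
    one_mul]

lemma Observable.IsCovariant.isAbsCont (hE : E.IsCovariant β) (hβ : IsPhaseSpaceSystem lam β d) :
    E.IsAbsCont lam := by
  intro S B hB h0
  have hEB : E B = 0 := by
    rcases subsingleton_or_nontrivial H with h | h
    · exact ContinuousLinearMap.ext fun x => Subsingleton.elim _ _
    · refine eq_zero_of_posTrace_eq_zero (E.positive B hB) ?_
      rw [hE.posTrace_eq hβ hB, h0, mul_zero]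
  rw [hEB, comp_zero]
  simp [tr]

end PhaseSpace

end CovObs

theorem mainTheorem6
    {G : Type*} [Group G] [TopologicalSpace G] [IsTopologicalGroup G] [T2Space G]
    [LocallyCompactSpace G] [SecondCountableTopology G] [MeasurableSpace G] [BorelSpace G]
    (lam : Measure G) [lam.IsHaarMeasure] [lam.IsMulRightInvariant]
    {H : Type*} [NormedAddCommGroup H] [InnerProductSpace ℂ H] [CompleteSpace H]
    [TopologicalSpace.SeparableSpace H]
    (β : G →* (CovObs.TraceClass H ≃ₗ[ℂ] CovObs.TraceClass H)) (d : ℝ)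
    (hβ : CovObs.IsPhaseSpaceSystem lam β d)
    (E : CovObs.Observable G H) :
    (E.IsAbsCont lam →
      ∃ Γ : Lp ℂ ∞ lam →ₗ[ℂ] (H →L[ℂ] H),
        (∀ (F : Lp ℂ ∞ lam) (f : G → ℂ), f =ᵐ[lam] F →
          ∀ A : H →L[ℂ] H, E.HasIntegral f A ↔ A = Γ F) ∧
        CovObs.IsNormalMap lam Γ ∧
        CovObs.IsPositiveMap lam Γ ∧
        Γ ((memLp_top_const (1 : ℂ)).toLp (fun _ => 1)) = 1 ∧
        (E.IsCovariant β → CovObs.IsCovariantMap lam β Γ)) ∧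
    (E.IsCovariant β →
      (Nontrivial H → ∀ B : Set G, MeasurableSet B →
        CovObs.posTrace (E B) = (ENNReal.ofReal d)⁻¹ * lam B) ∧
      E.IsAbsCont lam) := by
  refine ⟨fun hE => ⟨hE.operatorIntegral, fun F f hfF A => hE.hasIntegral_iff F hfF A,
    hE.isNormalMap_operatorIntegral, hE.isPositiveMap_operatorIntegral, hE.operatorIntegral_one,
    fun hcov => hE.isCovariantMap_operatorIntegral hcov⟩, fun hcov => ⟨?_, hcov.isAbsCont hβ⟩⟩
  intro _ B hB
  exact hcov.posTrace_eq hβ hB
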